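/- Let $N\ge 3$ be an integer, and let $T^2_N$ be the discrete torus, i.e. the Cayley graph of $\mathbb Z/N\mathbb Z\times\mathbb Z/N\mathbb Z$ with generating set $\{(0,1),(0,-1),(1,0),(-1,0)\}$. For $k_1,k_2\in\mathbb Z/N\mathbb Z$ put $$\mu(k_1,k_2)=2\cos\frac{2k_1\pi}{N}+2\cos\frac{2k_2\pi}{N},$$ and let $m(k_1,k_2)$ be the multiplicity of $\mu(k_1,k_2)$ as an eigenvalue of the adjacency matrix of $T^2_N$. (i) If $N$ is odd, then - $m(0,0)=1$; - $m(0,k)=m(k,k)=m(k,-k)=4$ for all $k\in\mathbb Z/N\mathbb Z\setminus\{0\}$; - $m(k_1,k_2)=8$ for all $k_1,k_2\in\mathbb Z/N\mathbb Z\setminus\{0\}$ with $k_1\ne\pm k_2$. (ii) If $N$ is even, $12\nmid N$, $30\nmid N$ and $42\nmid N$, then - $\mu(0,N/2)=0$ and $m(0,N/2)=2N-2$, and more generally $m(k_1,k_2)=2N-2$ whenever $\mu(k_1,k_2)=0$; - $m(0,0)=m(N/2,N/2)=1$; - $m(0,k)=m(N/2,k)=4$ for all $k\in\mathbb Z/N\mathbb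 Z\setminus\{0,N/2\}$, and $m(k,k)=m(k,-k)=4$ for all such $k$ with $\mu(k,k)\neq 0$; - $m(k_1,k_2)=8$ for all $k_1,k_2\in\mathbb Z/N\mathbb Z\setminus\{0,N/2\}$ with $k_1\ne\pm k_2$ and $\mu(k_1,k_2)\ne 0$. -/

import Mathlib

noncomputable section

namespace DiscreteTorus

/-- The generating set `{(0, 1), (0, -1), (1, 0), (-1, 0)}` of `ℤ/N × ℤ/N`. -/
def genSet (N : ℕ) : Set (ZMod N × ZMod N) :=
  {(0, 1), (0, -1), (1, 0), (-1, 0)}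

/-- The discrete torus `T²_N`: the Cayley graph of `ℤ/N × ℤ/N` with respect to `genSet N`. -/
def torus (N : ℕ) : SimpleGraph (ZMod N × ZMod N) :=
  SimpleGraph.addCayley (genSet N)

open Classical in
/-- The adjacency matrix of `T²_N`, with real entries. -/
def adj (N : ℕ) : Matrix (ZMod N × ZMod N) (ZMod N × ZMod N) ℝ :=
  (torus N).adjMatrix ℝ

/-- The spectrum `σ(T²_N)`: the multiset of eigenvalues of the adjacency matrix, each repeated
according to its multiplicity as a root of the characteristic polynomial. (The matrix is real
symmetric, so that all roots are real, and algebraic and geometric multiplicities agree.) -/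
def spec (N : ℕ) [NeZero N] : Multiset ℝ :=
  (adj N).charpoly.roots

/-- `μ_N(k₁, k₂) = 2 cos (2 k₁ π / N) + 2 cos (2 k₂ π / N)`, computed with the representatives
of `k₁, k₂` in `{0, …, N - 1}`. -/
def mu (N : ℕ) (k₁ k₂ : ZMod N) : ℝ :=
  2 * Real.cos (2 * (k₁.val : ℝ) / (N : ℝ) * Real.pi) +
    2 * Real.cos (2 * (k₂.val : ℝ) / (N : ℝ) * Real.pi)

/-- `m(k₁, k₂)`: the multiplicity of `μ_N(k₁, k₂)` in the spectrum of `T²_N`. -/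
def mult (N : ℕ) [NeZero N] (k₁ k₂ : ZMod N) : ℕ :=
  (spec N).count (mu N k₁ k₂)

/-- The residue class of `N / 2` in `ℤ/N`; only used for even `N`. -/
def half (N : ℕ) : ZMod N := ((N / 2 : ℕ) : ZMod N)

end DiscreteTorus

end

/-!
The characters of `(ℤ/N)²` diagonalise the adjacency matrix, and the eigenvalue of the character
attached to `(c, d)` is `mu N c d`. Hence `mult N a b` counts the solutions `(c, d)` of
`mu N c d = mu N a b`.

For `t` prime to `N`, the Galois automorphism `ζ ↦ ζ ^ t` of the `N`-th cyclotomic field turns this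
equation into the same relation between the values at `2 cos (2 π k / N)`, `k = a, b, c, d`, of the
polynomial `C t` with `C t (2 cos θ) = 2 cos (t θ)`. If `N` is odd, `t = 2` yields the product of
the two cosines from their sum. If `3 ∤ N` and the sum is nonzero, `t = 3` does. If `N` is even and
`3 ∣ N`, the divisibility conditions say that `5 ∤ N`, `7 ∤ N` and `4 ∤ N`. Were the two products
different, the relations for `t = 5` and `t = 7` together would force one of the four cosines to be
`0`, which `4 ∤ N` excludes. So, up to signs and order, `(c, d)` is `(a, b)`.

For even `N`, `mu N c d = 0` means `d = ±(c + N / 2)`: two solutions for each `c`, except for the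
two values of `c` where the signs give the same `d`.
-/

open Polynomial
open scoped Finset

section CayleyGraph

theorem charpoly_eq_prod_of_basis {R M ι : Type*} [CommRing R] [AddCommGroup M] [Module R M]
    [Module.Free R M] [Module.Finite R M] [Fintype ι]
    (f : Module.End R M) (b : Module.Basis ι R M) (μ : ι → R) (h : ∀ i, f (b i) = μ i • b i) :
    f.charpoly = ∏ i, (X - C (μ i)) := by
  classical
  have hdiag : LinearMap.toMatrix b b f = Matrix.diagonal μ := by
    ext i j
    rw [LinearMap.toMatrix_apply, h, map_smul, Module.Basis.repr_self, Finsupp.smul_single,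
      smul_eq_mul, mul_one, Finsupp.single_apply, Matrix.diagonal_apply]
    grind
  rw [← LinearMap.charpoly_toMatrix f b, hdiag, Matrix.charpoly_diagonal]

variable {G : Type*} [AddCommGroup G]

theorem addCayley_adj_iff_sub_mem {S : Set G} (h0 : 0 ∉ S) (hS : ∀ s ∈ S, -s ∈ S) (u v : G) :
    (SimpleGraph.addCayley S).Adj u v ↔ v - u ∈ S := by
  have hsymm : u - v ∈ S ↔ v - u ∈ S :=
    ⟨fun h => neg_sub u v ▸ hS _ h, fun h => neg_sub v u ▸ hS _ h⟩
  have hne : v - u ∈ S → u ≠ v := fun h huv => h0 (by rwa [huv, sub_self] at h)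
  rw [SimpleGraph.addCayley_adj, neg_add_eq_sub, neg_add_eq_sub, hsymm, or_self,
    and_iff_right_of_imp hne]

theorem charpoly_adjMatrix_addCayley [Fintype G] [DecidableEq G] {S : Finset G} (h0 : 0 ∉ S)
    (hS : ∀ s ∈ S, -s ∈ S) [DecidableRel (SimpleGraph.addCayley (S : Set G)).Adj] :
    ((SimpleGraph.addCayley (S : Set G)).adjMatrix ℂ).charpoly =
      ∏ ψ : AddChar G ℂ, (X - C (∑ s ∈ S, ψ s)) := by
  rw [← Matrix.charpoly_toLin']
  refine charpoly_eq_prod_of_basis _ (AddChar.complexBasis G) _ fun ψ => funext fun u => ?_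
  have hnbr : (SimpleGraph.addCayley (S : Set G)).neighborFinset u =
      S.map (addLeftEmbedding u) := by
    ext v
    rw [SimpleGraph.mem_neighborFinset, addCayley_adj_iff_sub_mem h0 hS]
    simp [← eq_sub_iff_add_eq']
  rw [AddChar.complexBasis_apply, Matrix.toLin'_apply, SimpleGraph.adjMatrix_mulVec_apply, hnbr,
    Finset.sum_map, Pi.smul_apply, smul_eq_mul, Finset.sum_mul]
  exact Finset.sum_congr rfl fun s _ => by
    rw [addLeftEmbedding_apply, AddChar.map_add_eq_mul, mul_comm]

end CayleyGraph

theorem aeval_pow_eq_zero_of_coprime {K : Type*} [CommRing K] [IsDomain K] [CharZero K] {n t : ℕ}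
    {ζ : K} (hζ : IsPrimitiveRoot ζ n) (hn : 0 < n) (ht : t.Coprime n) {P : ℤ[X]}
    (hP : aeval ζ P = 0) : aeval (ζ ^ t) P = 0 := by
  have hdvd : minpoly ℤ (ζ ^ t) ∣ P :=
    hζ.minpoly_eq_pow_coprime ht ▸ minpoly.isIntegrallyClosed_dvd (hζ.isIntegral hn) hP
  exact aeval_eq_zero_of_dvd_aeval_eq_zero hdvd (minpoly.aeval ℤ _)

section Chebyshev

variable {R : Type*} [CommRing R]

theorem chebyshevC_three : Chebyshev.C R 3 = X ^ 3 - 3 * X := by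
  have h : Chebyshev.C R 3 = X * Chebyshev.C R 2 - Chebyshev.C R 1 := Chebyshev.C_eq R 3
  rw [h, Chebyshev.C_two, Chebyshev.C_one]
  ring

theorem chebyshevC_five : Chebyshev.C R 5 = X ^ 5 - 5 * X ^ 3 + 5 * X := by
  have h : Chebyshev.C R 3 * Chebyshev.C R 2 = Chebyshev.C R 5 + Chebyshev.C R 1 :=
    Chebyshev.C_mul_C R 3 2
  rw [eq_sub_of_add_eq h.symm, chebyshevC_three, Chebyshev.C_two, Chebyshev.C_one]
  ring

theorem chebyshevC_seven : Chebyshev.C R 7 = X ^ 7 - 7 * X ^ 5 + 14 * X ^ 3 - 7 * X := by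
  have h : Chebyshev.C R 5 * Chebyshev.C R 2 = Chebyshev.C R 7 + Chebyshev.C R 3 :=
    Chebyshev.C_mul_C R 5 2
  rw [eq_sub_of_add_eq h.symm, chebyshevC_five, chebyshevC_three, Chebyshev.C_two]
  ring

end Chebyshev

section EqualSums

theorem eq_or_eq_of_add_eq_add_of_mul_eq_mul {R : Type*} [CommRing R] [NoZeroDivisors R]
    {x y z w : R} (hadd : x + y = z + w) (hmul : x * y = z * w) :
    (x = z ∧ y = w) ∨ (x = w ∧ y = z) := by
  have hroot : (x - z) * (x - w) = 0 := by linear_combination x * hadd - hmul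
  rcases mul_eq_zero.1 hroot with h | h
  · exact .inl ⟨sub_eq_zero.1 h, by linear_combination hadd - h⟩
  · exact .inr ⟨sub_eq_zero.1 h, by linear_combination hadd - h⟩

variable {K : Type*} [Field K] [CharZero K] {x y z w : K}

theorem mul_eq_mul_of_chebyshevC_two (hadd : x + y = z + w)
    (h : (Chebyshev.C K 2).eval x + (Chebyshev.C K 2).eval y =
      (Chebyshev.C K 2).eval z + (Chebyshev.C K 2).eval w) : x * y = z * w := by
  simp only [Chebyshev.C_two, eval_sub, eval_pow, eval_X, eval_ofNat] at h
  linear_combination (x + y + (z + w)) / 2 * hadd - h / 2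

theorem mul_eq_mul_of_chebyshevC_three (hadd : x + y = z + w) (h0 : x + y ≠ 0)
    (h : (Chebyshev.C K 3).eval x + (Chebyshev.C K 3).eval y =
      (Chebyshev.C K 3).eval z + (Chebyshev.C K 3).eval w) : x * y = z * w := by
  obtain rfl : w = x + y - z := by rw [hadd, add_sub_cancel_left]
  simp only [chebyshevC_three, eval_sub, eval_mul, eval_pow, eval_X, eval_ofNat] at h
  refine mul_left_cancel₀ h0 ?_
  linear_combination -h / 3

theorem mul_mul_mul_eq_zero_of_chebyshevC_five_seven (hadd : x + y = z + w) (h0 : x + y ≠ 0)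
    (hmul : x * y ≠ z * w)
    (h5 : (Chebyshev.C K 5).eval x + (Chebyshev.C K 5).eval y =
      (Chebyshev.C K 5).eval z + (Chebyshev.C K 5).eval w)
    (h7 : (Chebyshev.C K 7).eval x + (Chebyshev.C K 7).eval y =
      (Chebyshev.C K 7).eval z + (Chebyshev.C K 7).eval w) : x * y * (z * w) = 0 := by
  have hne : (x + y) * (x * y - z * w) ≠ 0 := mul_ne_zero h0 (sub_ne_zero.2 hmul)
  obtain rfl : w = x + y - z := by rw [hadd, add_sub_cancel_left]
  simp only [chebyshevC_five, chebyshevC_seven, eval_add, eval_sub, eval_mul, eval_pow, eval_X,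
    eval_ofNat] at h5 h7
  -- Divided by `s (p - q)`, the hypotheses `h5`, `h7` become the two relations below; eliminating
  -- `s ^ 2` between them leaves `p q = 0`.
  set s := x + y with hs
  set p := x * y with hp
  set q := z * (s - z) with hq
  have h5' : s ^ 2 = p + q + 3 := by
    refine mul_left_cancel₀ hne ?_
    rw [hp, hq, hs]
    linear_combination -h5 / 5
  have h7' : p ^ 2 + p * q + q ^ 2 - 2 * s ^ 2 * (p + q) + s ^ 4 + 5 * (p + q) - 5 * s ^ 2 + 6
      = 0 := by
    refine (mul_eq_zero_iff_left hne).1 ?_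
    rw [hp, hq, hs]
    linear_combination -h7 / 7
  linear_combination -h7' + (s ^ 2 - p - q - 2) * h5'

end EqualSums

section SymmOrbit

variable {α : Type*} [DecidableEq α]

/-- The orbit of `(a, b)` under sign changes of the coordinates and their exchange. It
always lies in one fibre of `mu`, so its size is the multiplicity when it is the whole fibre. -/
def symmOrbit [Neg α] (a b : α) : Finset (α × α) :=
  {a, -a} ×ˢ {b, -b} ∪ {b, -b} ×ˢ {a, -a}

theorem card_symmOrbit_self_of_eq_neg [Neg α] {a : α} (ha : a = -a) : #(symmOrbit a a) = 1 := by
  simp [symmOrbit, ← ha]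

theorem card_symmOrbit_self_of_ne_neg [Neg α] {a : α} (ha : a ≠ -a) : #(symmOrbit a a) = 4 := by
  rw [symmOrbit, Finset.union_self, Finset.card_product, Finset.card_pair ha]

theorem card_symmOrbit_of_ne [InvolutiveNeg α] {a b : α} (hab : a ≠ b) (hab' : a ≠ -b) :
    #(symmOrbit a b) = 2 * (#{a, -a} * #{b, -b}) := by
  have hdisj : Disjoint ({a, -a} : Finset α) {b, -b} := by
    simp only [Finset.disjoint_insert_left, Finset.disjoint_singleton_left, Finset.mem_insert,
      Finset.mem_singleton, neg_eq_iff_eq_neg, neg_neg, hab, hab', or_self, not_false_eq_true,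
      and_self]
  rw [symmOrbit, Finset.card_union_of_disjoint (Finset.disjoint_product.2 (.inl hdisj)),
    Finset.card_product, Finset.card_product]
  ring

theorem card_symmOrbit_of_eq_neg_of_ne_neg [InvolutiveNeg α] {a b : α} (ha : a = -a)
    (hb : b ≠ -b) : #(symmOrbit a b) = 4 := by
  have hab : a ≠ b := fun h => hb (h ▸ ha)
  have hab' : a ≠ -b := fun h => hab (ha.trans (by rw [h, neg_neg]))
  rw [card_symmOrbit_of_ne hab hab', ← ha, Finset.pair_eq_singleton, Finset.card_singleton,
    Finset.card_pair hb]

theorem card_symmOrbit_of_ne_neg_of_ne_neg [InvolutiveNeg α] {a b : α} (ha : a ≠ -a)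
    (hb : b ≠ -b) (hab : a ≠ b) (hab' : a ≠ -b) : #(symmOrbit a b) = 8 := by
  rw [card_symmOrbit_of_ne hab hab', Finset.card_pair ha, Finset.card_pair hb]

end SymmOrbit

namespace DiscreteTorus

open ZMod (stdAddChar)

/-- `2 cos (2 π k / N)`, so that `mu N a b = twoCos a + twoCos b` holds by definition. -/
noncomputable def twoCos {N : ℕ} (k : ZMod N) : ℝ :=
  2 * Real.cos (2 * (k.val : ℝ) / (N : ℝ) * Real.pi)

theorem mu_eq_add {N : ℕ} (a b : ZMod N) : mu N a b = twoCos a + twoCos b := rfl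

variable {N : ℕ} [NeZero N]

theorem ofReal_twoCos (k : ZMod N) : (twoCos k : ℂ) = stdAddChar k + stdAddChar (-k) := by
  rw [AddChar.map_neg_eq_inv, ZMod.stdAddChar_apply, ZMod.toCircle_eq_circleExp, Circle.coe_exp,
    ← Complex.exp_neg, twoCos]
  push_cast
  rw [Complex.cos]
  ring_nf

section Spectrum

/-- The character `(x, y) ↦ exp (2 π i (a x + b y) / N)` of `ℤ/N × ℤ/N` attached to `(a, b)`. -/
noncomputable def torusChar (k : ZMod N × ZMod N) : AddChar (ZMod N × ZMod N) ℂ :=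
  (AddChar.mulShift stdAddChar k.1).compAddMonoidHom (AddMonoidHom.fst _ _) *
    (AddChar.mulShift stdAddChar k.2).compAddMonoidHom (AddMonoidHom.snd _ _)

theorem torusChar_apply (k x : ZMod N × ZMod N) :
    torusChar k x = stdAddChar (k.1 * x.1) * stdAddChar (k.2 * x.2) := rfl

theorem torusChar_bijective : Function.Bijective (torusChar (N := N)) := by
  rw [Fintype.bijective_iff_injective_and_card, AddChar.card_eq]
  refine ⟨fun k l h => Prod.ext ?_ ?_, rfl⟩ <;> apply ZMod.injective_stdAddChar
  · simpa [torusChar_apply] using DFunLike.congr_fun h (1, 0)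
  · simpa [torusChar_apply] using DFunLike.congr_fun h (0, 1)

/-- `genSet N` as a `Finset`, over which character values can be summed. -/
def genFinset (N : ℕ) : Finset (ZMod N × ZMod N) := {(0, 1), (0, -1), (1, 0), (-1, 0)}

theorem coe_genFinset (N : ℕ) : (genFinset N : Set (ZMod N × ZMod N)) = genSet N := by
  simp [genFinset, genSet]

theorem sum_torusChar_genFinset (hN : 3 ≤ N) (k : ZMod N × ZMod N) :
    ∑ s ∈ genFinset N, torusChar k s = mu N k.1 k.2 := by
  have : Fact (1 < N) := ⟨by omega⟩
  have : Fact (2 < N) := ⟨hN⟩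
  have hne : (1 : ZMod N) ≠ -1 := ZMod.neg_one_ne_one.symm
  rw [genFinset, Finset.sum_insert (by simp [hne]), Finset.sum_insert (by simp),
    Finset.sum_insert (by simp [hne]), Finset.sum_singleton, mu_eq_add, Complex.ofReal_add,
    ofReal_twoCos, ofReal_twoCos]
  simp only [torusChar_apply, mul_zero, mul_one, mul_neg, AddChar.map_zero_eq_one, one_mul]
  ring

theorem charpoly_adj (hN : 3 ≤ N) :
    (adj N).charpoly = ∏ k : ZMod N × ZMod N, (X - C (mu N k.1 k.2)) := by
  classical
  have : Fact (1 < N) := ⟨by omega⟩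
  have h0 : (0 : ZMod N × ZMod N) ∉ genFinset N := by simp [genFinset, Prod.ext_iff]
  have hneg : ∀ s ∈ genFinset N, -s ∈ genFinset N := by simp [genFinset]
  apply map_injective (algebraMap ℝ ℂ) (algebraMap ℝ ℂ).injective
  have hadj : (adj N).map (algebraMap ℝ ℂ) =
      (SimpleGraph.addCayley (genFinset N : Set (ZMod N × ZMod N))).adjMatrix ℂ := by
    ext u v
    rw [Matrix.map_apply, adj, SimpleGraph.adjMatrix_apply, SimpleGraph.adjMatrix_apply, torus,
      apply_ite (algebraMap ℝ ℂ), map_one, map_zero]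
    simp only [coe_genFinset]
    split_ifs <;> rfl
  rw [← Matrix.charpoly_map, hadj, charpoly_adjMatrix_addCayley h0 hneg,
    ← torusChar_bijective.prod_comp fun ψ => X - C (∑ s ∈ genFinset N, ψ s), Polynomial.map_prod]
  simp only [sum_torusChar_genFinset hN, Polynomial.map_sub, map_X, map_C, Complex.coe_algebraMap]

theorem spec_eq_map (hN : 3 ≤ N) :
    spec N = Finset.univ.val.map fun k : ZMod N × ZMod N => mu N k.1 k.2 := by
  rw [← roots_multiset_prod_X_sub_C (Multiset.map _ _), Multiset.map_map, spec, charpoly_adj hN]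
  rfl

theorem mult_eq_card (hN : 3 ≤ N) (a b : ZMod N) :
    mult N a b = #{k : ZMod N × ZMod N | mu N k.1 k.2 = mu N a b} := by
  rw [mult, spec_eq_map hN, Multiset.count_map]
  simp only [eq_comm]
  rfl

end Spectrum

section Cosines

theorem twoCos_intCast (j : ℤ) :
    twoCos (j : ZMod N) = 2 * Real.cos (2 * Real.pi * j / N) := by
  apply Complex.ofReal_injective
  rw [ofReal_twoCos, ← Int.cast_neg, ZMod.stdAddChar_coe, ZMod.stdAddChar_coe]
  push_cast
  rw [Complex.cos]
  ring_nf

theorem twoCos_neg (k : ZMod N) : twoCos (-k) = twoCos k := by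
  apply Complex.ofReal_injective
  rw [ofReal_twoCos, ofReal_twoCos, neg_neg, add_comm]

theorem twoCos_intCast_mul (t : ℤ) (k : ZMod N) :
    twoCos ((t : ZMod N) * k) = (Chebyshev.C ℝ t).eval (twoCos k) := by
  obtain ⟨j, rfl⟩ := ZMod.intCast_surjective k
  rw [← Int.cast_mul, twoCos_intCast, twoCos_intCast, Chebyshev.C_two_mul_real_cos]
  push_cast
  ring_nf

theorem twoCos_eq_twoCos_iff {k l : ZMod N} : twoCos k = twoCos l ↔ k = l ∨ k = -l := by
  refine ⟨fun h => ?_, ?_⟩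
  · have hadd : (stdAddChar k + stdAddChar (-k) : ℂ) = stdAddChar l + stdAddChar (-l) := by
      rw [← ofReal_twoCos, ← ofReal_twoCos, h]
    have hmul : (stdAddChar k * stdAddChar (-k) : ℂ) = stdAddChar l * stdAddChar (-l) := by
      simp only [← AddChar.map_add_eq_mul, add_neg_cancel]
    exact (eq_or_eq_of_add_eq_add_of_mul_eq_mul hadd hmul).imp
      (fun h => ZMod.injective_stdAddChar h.1) (fun h => ZMod.injective_stdAddChar h.1)
  · rintro (rfl | rfl)
    exacts [rfl, twoCos_neg l]

theorem twoCos_ne_zero (hN : ¬ 4 ∣ N) (k : ZMod N) : twoCos k ≠ 0 := by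
  intro h
  have hsum : (stdAddChar k + stdAddChar (-k) : ℂ) = 0 := by
    rw [← ofReal_twoCos, h, Complex.ofReal_zero]
  have hmul : (stdAddChar k * stdAddChar (-k) : ℂ) = 1 := by
    rw [← AddChar.map_add_eq_mul, add_neg_cancel, AddChar.map_zero_eq_one]
  have hsq : (stdAddChar k : ℂ) ^ 2 = -1 := by linear_combination stdAddChar k * hsum - hmul
  have horder : orderOf (stdAddChar k : ℂ) = 2 ^ 2 :=
    orderOf_eq_prime_pow (by rw [pow_one, hsq]; norm_num)
      (by linear_combination (stdAddChar k ^ 2 - 1 : ℂ) * hsq)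
  refine hN ((horder.symm.dvd : 4 ∣ _).trans (orderOf_dvd_of_pow_eq_one ?_))
  rw [← AddChar.map_nsmul_eq_pow, nsmul_eq_mul, ZMod.natCast_self, zero_mul,
    AddChar.map_zero_eq_one]

theorem mult_neg_right (a b : ZMod N) : mult N a (-b) = mult N a b := by
  rw [mult, mult, mu_eq_add, mu_eq_add, twoCos_neg]

end Cosines

section Galois

theorem isPrimitiveRoot_stdAddChar_one : IsPrimitiveRoot (stdAddChar (1 : ZMod N) : ℂ) N := by
  have h := ZMod.stdAddChar_coe (N := N) 1
  rw [Int.cast_one, Int.cast_one, mul_one] at h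
  exact h ▸ Complex.isPrimitiveRoot_exp N (NeZero.ne N)

theorem sum_intCast_mul_twoCos_mul_eq_zero {t : ℕ} (ht : t.Coprime N) {ι : Type*} (s : Finset ι)
    (c : ι → ℤ) (k : ι → ZMod N) (h : ∑ i ∈ s, c i * twoCos (k i) = 0) :
    ∑ i ∈ s, c i * twoCos ((t : ZMod N) * k i) = 0 := by
  have hpow (r : ℕ) (l : ZMod N) :
      ((stdAddChar (1 : ZMod N) : ℂ) ^ r) ^ l.val = stdAddChar ((r : ZMod N) * l) := by
    rw [← pow_mul, ← AddChar.map_nsmul_eq_pow, nsmul_one, Nat.cast_mul, ZMod.natCast_zmod_val]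
  let P : ℤ[X] := ∑ i ∈ s, C (c i) * (X ^ (k i).val + X ^ (-k i).val)
  have hP (r : ℕ) : aeval ((stdAddChar (1 : ZMod N) : ℂ) ^ r) P =
      (∑ i ∈ s, c i * twoCos ((r : ZMod N) * k i) : ℝ) := by
    simp [P, hpow, ofReal_twoCos]
  have hroot : aeval (stdAddChar (1 : ZMod N) : ℂ) P = 0 := by
    rw [← pow_one (stdAddChar (1 : ZMod N)), hP]
    simp [h]
  have hconj := aeval_pow_eq_zero_of_coprime isPrimitiveRoot_stdAddChar_one (NeZero.pos N) ht hroot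
  exact_mod_cast (hP t).symm.trans hconj

theorem eval_chebyshev_add_eq {t : ℕ} (ht : t.Coprime N) {a b c d : ZMod N}
    (h : mu N a b = mu N c d) :
    (Chebyshev.C ℝ t).eval (twoCos a) + (Chebyshev.C ℝ t).eval (twoCos b) =
      (Chebyshev.C ℝ t).eval (twoCos c) + (Chebyshev.C ℝ t).eval (twoCos d) := by
  have hexpand (f : ZMod N → ℝ) :
      ∑ i, ((![1, 1, -1, -1] : Fin 4 → ℤ) i : ℝ) * f (![a, b, c, d] i) =
        f a + f b - (f c + f d) := by
    simp only [Fin.sum_univ_four, Matrix.cons_val, Int.cast_one, one_mul, Int.cast_neg, neg_mul]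
    ring
  have hsum := sum_intCast_mul_twoCos_mul_eq_zero ht Finset.univ ![1, 1, -1, -1] ![a, b, c, d]
    (by rw [hexpand, ← mu_eq_add, ← mu_eq_add, h, sub_self])
  have hmul (k : ZMod N) : twoCos ((t : ZMod N) * k) = (Chebyshev.C ℝ t).eval (twoCos k) := by
    simpa using twoCos_intCast_mul t k
  rw [hexpand fun k => twoCos ((t : ZMod N) * k)] at hsum
  simpa only [hmul, sub_eq_zero] using hsum

end Galois

section Rigidity

/-- `(a, b)` is rigid if `mu N c d = mu N a b` only for the pairs `(c, d)` forced by the symmetries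
of `mu N`. -/
def IsRigid (a b : ZMod N) : Prop :=
  ∀ c d : ZMod N, mu N c d = mu N a b → (c, d) ∈ symmOrbit a b

theorem mem_symmOrbit_iff {a b c d : ZMod N} :
    (c, d) ∈ symmOrbit a b ↔ (twoCos c = twoCos a ∧ twoCos d = twoCos b) ∨
      (twoCos c = twoCos b ∧ twoCos d = twoCos a) := by
  simp [symmOrbit, twoCos_eq_twoCos_iff]

theorem mult_eq_card_symmOrbit (hN : 3 ≤ N) {a b : ZMod N} (hab : IsRigid a b) :
    mult N a b = #(symmOrbit a b) := by
  rw [mult_eq_card hN]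
  congr 1
  ext ⟨c, d⟩
  refine (Finset.mem_filter_univ _).trans ⟨hab c d, fun hmem => ?_⟩
  rcases mem_symmOrbit_iff.1 hmem with ⟨hc, hd⟩ | ⟨hc, hd⟩
  · rw [mu_eq_add, mu_eq_add, hc, hd]
  · rw [mu_eq_add, mu_eq_add, hc, hd, add_comm]

theorem isRigid_of_mul_eq_mul {a b : ZMod N}
    (h : ∀ c d : ZMod N, mu N c d = mu N a b →
      twoCos c * twoCos d = twoCos a * twoCos b) : IsRigid a b :=
  fun c d hmu => mem_symmOrbit_iff.2 (eq_or_eq_of_add_eq_add_of_mul_eq_mul hmu (h c d hmu))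

theorem isRigid_of_odd (hN : Odd N) (a b : ZMod N) : IsRigid a b :=
  isRigid_of_mul_eq_mul fun _ _ hmu => mul_eq_mul_of_chebyshevC_two hmu <|
    eval_chebyshev_add_eq (Nat.coprime_two_left.2 hN) hmu

theorem isRigid_of_not_three_dvd (hN : ¬ 3 ∣ N) {a b : ZMod N} (hab : mu N a b ≠ 0) :
    IsRigid a b :=
  isRigid_of_mul_eq_mul fun _ _ hmu => mul_eq_mul_of_chebyshevC_three hmu (hmu.trans_ne hab) <|
    eval_chebyshev_add_eq ((Nat.Prime.coprime_iff_not_dvd Nat.prime_three).2 hN) hmu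

theorem isRigid_of_not_four_dvd (h4 : ¬ 4 ∣ N) (h5 : ¬ 5 ∣ N) (h7 : ¬ 7 ∣ N) {a b : ZMod N}
    (hab : mu N a b ≠ 0) : IsRigid a b := by
  refine isRigid_of_mul_eq_mul fun c d hmu => ?_
  by_contra hmul
  have hprod := mul_mul_mul_eq_zero_of_chebyshevC_five_seven hmu (hmu.trans_ne hab) hmul
    (eval_chebyshev_add_eq ((Nat.Prime.coprime_iff_not_dvd Nat.prime_five).2 h5) hmu)
    (eval_chebyshev_add_eq ((Nat.Prime.coprime_iff_not_dvd Nat.prime_seven).2 h7) hmu)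
  exact mul_ne_zero (mul_ne_zero (twoCos_ne_zero h4 c) (twoCos_ne_zero h4 d))
    (mul_ne_zero (twoCos_ne_zero h4 a) (twoCos_ne_zero h4 b)) hprod

theorem isRigid_of_even (hN : Even N) (h12 : ¬ 12 ∣ N) (h30 : ¬ 30 ∣ N) (h42 : ¬ 42 ∣ N)
    {a b : ZMod N} (hab : mu N a b ≠ 0) : IsRigid a b := by
  by_cases h3 : 3 ∣ N
  · have h2 := hN.two_dvd
    exact isRigid_of_not_four_dvd (by omega) (by omega) (by omega) hab
  · exact isRigid_of_not_three_dvd h3 hab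

end Rigidity

section Half

theorem half_add_half {N : ℕ} (hN : Even N) : half N + half N = 0 := by
  rw [half, ← Nat.cast_add, ← two_mul, Nat.two_mul_div_two_of_even hN, ZMod.natCast_self]

theorem neg_half {N : ℕ} (hN : Even N) : -half N = half N :=
  neg_eq_of_add_eq_zero_left (half_add_half hN)

theorem val_half : (half N).val = N / 2 :=
  ZMod.val_natCast_of_lt (Nat.div_lt_self (NeZero.pos N) one_lt_two)

theorem eq_neg_iff_of_even (hN : Even N) (k : ZMod N) : k = -k ↔ k = 0 ∨ k = half N := by
  have hval : k = half N ↔ 2 * k.val = N := by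
    rw [← (ZMod.val_injective N).eq_iff, val_half]
    have := hN.two_dvd
    omega
  rw [eq_comm, ZMod.neg_eq_self_iff, hval]

theorem half_ne_zero (hN : Even N) : half N ≠ 0 := by
  rw [← ZMod.val_ne_zero, val_half]
  have := NeZero.pos N
  have := hN.two_dvd
  omega

theorem twoCos_add_half (hN : Even N) (k : ZMod N) : twoCos (k + half N) = -twoCos k := by
  obtain ⟨j, rfl⟩ := ZMod.intCast_surjective k
  have hcast : (j : ZMod N) + half N = ((j + (N / 2 : ℕ) : ℤ) : ZMod N) := by
    rw [half, Int.cast_add, Int.cast_natCast]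
  have hangle : 2 * Real.pi * (j + (N / 2 : ℕ) : ℤ) / N = 2 * Real.pi * j / N + Real.pi := by
    have hN0 : (N : ℝ) ≠ 0 := NeZero.ne _
    rw [Int.cast_add, Int.cast_natCast, Nat.cast_div_charZero hN.two_dvd, Nat.cast_two]
    field_simp
  rw [hcast, twoCos_intCast, twoCos_intCast, hangle, Real.cos_add_pi, mul_neg]

theorem mu_eq_zero_iff (hN : Even N) {a b : ZMod N} :
    mu N a b = 0 ↔ b = a + half N ∨ b = -(a + half N) := by
  rw [← twoCos_eq_twoCos_iff, twoCos_add_half hN, mu_eq_add, add_comm, add_eq_zero_iff_eq_neg]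

theorem mu_zero_left_eq_zero_iff (hN : Even N) {k : ZMod N} : mu N 0 k = 0 ↔ k = half N := by
  rw [mu_eq_zero_iff hN, zero_add, neg_half hN, or_self]

theorem mu_half_left_eq_zero_iff (hN : Even N) {k : ZMod N} : mu N (half N) k = 0 ↔ k = 0 := by
  rw [mu_eq_zero_iff hN, half_add_half hN, neg_zero, or_self]

theorem sum_card_pair_neg (hN : Even N) : ∑ k : ZMod N, #{k, -k} = 2 * N - 2 := by
  have hfixed : #{k : ZMod N | k = -k} = 2 := by
    rw [← Finset.card_pair (half_ne_zero hN).symm]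
    congr 1
    ext k
    simp [eq_neg_iff_of_even hN]
  have hpair (k : ZMod N) : #{k, -k} + (if k = -k then 1 else 0) = 2 := by
    split_ifs with hk
    · rw [← hk, Finset.pair_eq_singleton, Finset.card_singleton]
    · rw [Finset.card_pair hk]
  have htotal : ∑ k : ZMod N, #{k, -k} + #{k : ZMod N | k = -k} = 2 * N := by
    rw [Finset.card_filter, ← Finset.sum_add_distrib, Finset.sum_congr rfl fun k _ => hpair k,
      Finset.sum_const, Finset.card_univ, ZMod.card, smul_eq_mul, mul_comm]
  omega

theorem mult_eq_of_mu_eq_zero (hN : 3 ≤ N) (hE : Even N) {a b : ZMod N} (hab : mu N a b = 0) :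
    mult N a b = 2 * N - 2 := by
  have hfiber (c : ZMod N) :
      ({d | mu N c d = 0} : Finset (ZMod N)) = {c + half N, -(c + half N)} := by
    ext d
    simp [mu_eq_zero_iff hE]
  calc mult N a b = #{k : ZMod N × ZMod N | mu N k.1 k.2 = 0} := by rw [mult_eq_card hN, hab]
    _ = ∑ c : ZMod N, #{d : ZMod N | mu N c d = 0} := by
      simp only [Finset.card_filter, Fintype.sum_prod_type]
    _ = ∑ c : ZMod N, #{c + half N, -(c + half N)} := by simp only [hfiber]
    _ = ∑ k : ZMod N, #{k, -k} :=
      Equiv.sum_comp (Equiv.addRight (half N)) fun k : ZMod N => #{k, -k}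
    _ = 2 * N - 2 := sum_card_pair_neg hE

end Half

end DiscreteTorus

theorem proposition2p3 (N : ℕ) [NeZero N] (hN : 3 ≤ N) :
    (Odd N →
      DiscreteTorus.mult N 0 0 = 1 ∧
      (∀ k : ZMod N, k ≠ 0 →
        DiscreteTorus.mult N 0 k = 4 ∧ DiscreteTorus.mult N k k = 4 ∧
          DiscreteTorus.mult N k (-k) = 4) ∧
      (∀ k₁ k₂ : ZMod N, k₁ ≠ 0 → k₂ ≠ 0 → k₁ ≠ k₂ → k₁ ≠ -k₂ →
        DiscreteTorus.mult N k₁ k₂ = 8)) ∧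
    (Even N → ¬ 12 ∣ N → ¬ 30 ∣ N → ¬ 42 ∣ N →
      DiscreteTorus.mu N 0 (DiscreteTorus.half N) = 0 ∧
      DiscreteTorus.mult N 0 (DiscreteTorus.half N) = 2 * N - 2 ∧
      (∀ k₁ k₂ : ZMod N, DiscreteTorus.mu N k₁ k₂ = 0 →
        DiscreteTorus.mult N k₁ k₂ = 2 * N - 2) ∧
      DiscreteTorus.mult N 0 0 = 1 ∧
      DiscreteTorus.mult N (DiscreteTorus.half N) (DiscreteTorus.half N) = 1 ∧
      (∀ k : ZMod N, k ≠ 0 → k ≠ DiscreteTorus.half N →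
        DiscreteTorus.mult N 0 k = 4 ∧ DiscreteTorus.mult N (DiscreteTorus.half N) k = 4 ∧
          (DiscreteTorus.mu N k k ≠ 0 →
            DiscreteTorus.mult N k k = 4 ∧ DiscreteTorus.mult N k (-k) = 4)) ∧
      (∀ k₁ k₂ : ZMod N, k₁ ≠ 0 → k₁ ≠ DiscreteTorus.half N →
        k₂ ≠ 0 → k₂ ≠ DiscreteTorus.half N → k₁ ≠ k₂ → k₁ ≠ -k₂ →
        DiscreteTorus.mu N k₁ k₂ ≠ 0 → DiscreteTorus.mult N k₁ k₂ = 8)) := by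
  open DiscreteTorus in
  refine ⟨fun hO => ?_, fun hE h12 h30 h42 => ?_⟩
  · have hmult (a b : ZMod N) := mult_eq_card_symmOrbit hN (isRigid_of_odd hO a b)
    have hne {k : ZMod N} (hk : k ≠ 0) : k ≠ -k := ZMod.ne_neg_self hO hk
    simp_rw [mult_neg_right, hmult]
    exact ⟨card_symmOrbit_self_of_eq_neg neg_zero.symm,
      fun k hk => ⟨card_symmOrbit_of_eq_neg_of_ne_neg neg_zero.symm (hne hk),
        card_symmOrbit_self_of_ne_neg (hne hk), card_symmOrbit_self_of_ne_neg (hne hk)⟩,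
      fun k₁ k₂ h₁ h₂ => card_symmOrbit_of_ne_neg_of_ne_neg (hne h₁) (hne h₂)⟩
  · have hmult {a b : ZMod N} (hab : mu N a b ≠ 0) : mult N a b = #(symmOrbit a b) :=
      mult_eq_card_symmOrbit hN (isRigid_of_even hE h12 h30 h42 hab)
    have hne {k : ZMod N} (hk : k ≠ 0) (hk' : k ≠ half N) : k ≠ -k := by
      simp [eq_neg_iff_of_even hE, hk, hk']
    have hhalf : half N = -half N := (neg_half hE).symm
    have hμ : mu N 0 (half N) = 0 := (mu_zero_left_eq_zero_iff hE).2 rfl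
    refine ⟨hμ, mult_eq_of_mu_eq_zero hN hE hμ, fun _ _ => mult_eq_of_mu_eq_zero hN hE, ?_, ?_,
      fun k hk hk' => ⟨?_, ?_, fun hkk => ?_⟩, fun k₁ k₂ h₁ h₁' h₂ h₂' hne₁ hne₂ hμ₁₂ => ?_⟩
    · rw [hmult (mt (mu_zero_left_eq_zero_iff hE).1 (half_ne_zero hE).symm),
        card_symmOrbit_self_of_eq_neg neg_zero.symm]
    · rw [hmult (mt (mu_half_left_eq_zero_iff hE).1 (half_ne_zero hE)),
        card_symmOrbit_self_of_eq_neg hhalf]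
    · rw [hmult (mt (mu_zero_left_eq_zero_iff hE).1 hk'),
        card_symmOrbit_of_eq_neg_of_ne_neg neg_zero.symm (hne hk hk')]
    · rw [hmult (mt (mu_half_left_eq_zero_iff hE).1 hk),
        card_symmOrbit_of_eq_neg_of_ne_neg hhalf (hne hk hk')]
    · rw [mult_neg_right, and_self, hmult hkk, card_symmOrbit_self_of_ne_neg (hne hk hk')]
    · rw [hmult hμ₁₂, card_symmOrbit_of_ne_neg_of_ne_neg (hne h₁ h₁') (hne h₂ h₂') hne₁ hne₂]
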